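/- Let $X$ be a real Banach space, $Y$ a real normed space, $\Omega\subset X$ nonempty and closed, $f_1,\dots,f_m\colon X\to\mathbb R$ locally Lipschitz, $K\subset Y$ a closed convex cone, and $g\colon X\to Y$ continuous and $K$-convex, i.e. $g(\theta x+(1-\theta)y)-\theta g(x)-(1-\theta)g(y)\in -K$ for all $x,y\in X$, $\theta\in[0,1]$. Put $C=\{x\in\Omega : g(x)\in -K\}$, let $K^+=\{s\in Y^*:\langle s,k\rangle\ge 0\ \forall k\in K\}$ be the positive polar cone, $B_{X^*}$ and $B_{Y^*}$ the closed dual unit balls, and $g_s(x)=\langle s,g(x)\rangle$ for $s\in Y^*$. For a locally Lipschitz $\varphi\colon X\to\mathbb R$ let $\varphi^\circ(\bar x;d)=\limsup_{x\to\bar x,\ t\downarrow 0}\frac{\varphi(x+td)-\varphi(x)}{t}$ and $\partial\varphi(\bar x)=\{x^*\in X^*:\langle x^*,d\rangle\le\varphi^\circ(\bar x;d)\ \forall d\in X\}$ be the Clarke directional derivative and subdifferential. Let $d_\Omega$ be the distance function to $\Omega$, and let $T(\bar x;\Omega)=\{v\in X: d_\Omega^\circ(\bar x;v)=0\}$ and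 $N(\bar x;\Omega)=\{x^*\in X^*:\langle x^*,v\rangle\le 0\ \forall v\in T(\bar x;\Omega)\}$ be the Clarke tangent and normal cones. Let $T$ be $K^+\cap B_{Y^*}$ or, more generally, any weak$^*$-closed subset of $K^+\cap B_{Y^*}$ such that, for every $x\in X$, $g(x)\in -K$ if and only if $g_s(x)\le 0$ for all $s\in T$. Put $G(x)=\sup_{s\in T}g_s(x)$ and $I(\bar x)=\{s\in T: g_s(\bar x)=G(\bar x)\}$. Let $\xi\in\mathbb R^m_+\setminus\{0\}$ and let $\bar x\in C$ be a $\xi$-quasi-weakly Pareto solution, i.e. there is no $x\in C$ with $f_i(x)+\|x-\bar x\|\,\xi_i<f_i(\bar x)$ for all $i=1,\dots,m$. Assume that ($\mathcal U$) there is $\bar d\in T(\bar x;\Omega)$ with $G^\circ(\bar x;\bar d)<0$, and that the convex hull of $\bigcup_{s\in I(\bar x)}\partial g_s(\bar x)$ is weak$^*$-closed in $X^*$. Then there exist $\lambda\in\mathbb R^m_+$ with $\sum_{i=1}^m\lambda_i=1$ and $\zeta\in K^+$ such that $$0\in\sum_{i=1}^m\lambda_i\,\partial f_i(\bar x)+\partial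 g_\zeta(\bar x)+\Big(\sum_{i=1}^m\lambda_i\xi_i\Big)B_{X^*}+N(\bar x;\Omega).$$ -/

import Mathlib

open Set Filter Topology
open scoped Pointwise

noncomputable section

section Clarke

variable {X : Type*} [NormedAddCommGroup X] [NormedSpace ℝ X]

/-- The Clarke generalized directional derivative
`φ°(x̄; d) = limsup_{x → x̄, t ↓ 0} (φ (x + t d) - φ x) / t`. It is used for functions that are
Lipschitz near `x̄`, for which the quotients are bounded and the real limsup is the true one. -/
def clarkeDeriv (φ : X → ℝ) (xbar d : X) : ℝ :=
  limsup (fun p : X × ℝ => (φ (p.1 + p.2 • d) - φ p.1) / p.2) (𝓝 xbar ×ˢ 𝓝[>] (0 : ℝ))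

/-- The Clarke subdifferential `∂φ(x̄)`. -/
def clarkeSubdiff (φ : X → ℝ) (xbar : X) : Set (StrongDual ℝ X) :=
  {p | ∀ d : X, p d ≤ clarkeDeriv φ xbar d}

/-- The Clarke tangent cone `T(x̄; S)`, defined through the distance function to `S`. -/
def clarkeTangentCone (S : Set X) (xbar : X) : Set X :=
  {v | clarkeDeriv (fun x => Metric.infDist x S) xbar v = 0}

/-- The Clarke normal cone `N(x̄; S)`, the polar cone of the Clarke tangent cone. -/
def clarkeNormalCone (S : Set X) (xbar : X) : Set (StrongDual ℝ X) :=
  {p | ∀ v ∈ clarkeTangentCone S xbar, p v ≤ 0}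

/-- A set of continuous linear functionals is weak*-closed. -/
def IsWeakStarClosed (A : Set (StrongDual ℝ X)) : Prop :=
  IsClosed (StrongDual.toWeakDual '' A : Set (WeakDual ℝ X))

/-- `x̄` is a `ξ`-quasi-weakly Pareto solution of minimizing `f = (f₁, …, f_m)` over `C`. -/
def IsQuasiWeaklyPareto {m : ℕ} (f : Fin m → X → ℝ) (C : Set X) (ξ : Fin m → ℝ)
    (xbar : X) : Prop :=
  xbar ∈ C ∧ ¬ ∃ x ∈ C, ∀ i, f i x + ‖x - xbar‖ * ξ i < f i xbar

end Clarke

section Cone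

variable {X : Type*} [NormedAddCommGroup X] [NormedSpace ℝ X] {Y : Type*} [NormedAddCommGroup Y] [NormedSpace ℝ Y]

/-- The positive polar cone `K⁺` of a closed convex cone `K`. -/
def positivePolar (K : ProperCone ℝ Y) : Set (StrongDual ℝ Y) :=
  {s | ∀ k ∈ K, 0 ≤ s k}

/-- `g` is `K`-convex: `g(θx + (1-θ)y) - θ g(x) - (1-θ) g(y) ∈ -K`. -/
def IsConeConvex (K : ProperCone ℝ Y) (g : X → Y) : Prop :=
  ∀ x y : X, ∀ θ ∈ Icc (0 : ℝ) 1,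
    -(g (θ • x + (1 - θ) • y) - θ • g x - (1 - θ) • g y) ∈ K

/-- The feasible set `{x ∈ Ω | g(x) ∈ -K}`. -/
def coneFeasible (Ω : Set X) (K : ProperCone ℝ Y) (g : X → Y) : Set X :=
  {x ∈ Ω | -g x ∈ K}

/-- The scalarization `g_s(x) = ⟨s, g(x)⟩`. -/
def scalarization (g : X → Y) (s : StrongDual ℝ Y) (x : X) : ℝ := s (g x)

/-- The function `G(x) = sup_{s ∈ T} g_s(x)`. -/
def supFun (g : X → Y) (T : Set (StrongDual ℝ Y)) (x : X) : ℝ :=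
  sSup ((fun s => scalarization g s x) '' T)

/-- The active indices `{s ∈ T | g_s(x) = G(x)}`. -/
def activeIndices (g : X → Y) (T : Set (StrongDual ℝ Y)) (x : X) : Set (StrongDual ℝ Y) :=
  {s ∈ T | scalarization g s x = supFun g T x}

/-- `T` is an index set for rewriting the constraint `g(x) ∈ -K` as the inequalities
`g_s(x) ≤ 0`, `s ∈ T`: a weak*-closed (hence weak*-compact) part of `K⁺ ∩ B_{Y*}` for which the
two are equivalent. The full set `K⁺ ∩ B_{Y*}` always is one, see
`isIndexSet_positivePolar_inter_closedBall`. -/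
structure IsIndexSet (K : ProperCone ℝ Y) (g : X → Y) (T : Set (StrongDual ℝ Y)) : Prop where
  subset : T ⊆ positivePolar K ∩ Metric.closedBall 0 1
  closed : IsWeakStarClosed T
  feasible_iff : ∀ x : X, -g x ∈ K ↔ ∀ s ∈ T, scalarization g s x ≤ 0

end Cone

/-- The set `K⁺ ∩ B_{Y*}` is an index set. -/
theorem isIndexSet_positivePolar_inter_closedBall {X Y : Type*} [NormedAddCommGroup Y]
    [NormedSpace ℝ Y] (K : ProperCone ℝ Y) (g : X → Y) :
    IsIndexSet K g (positivePolar K ∩ Metric.closedBall 0 1) where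
  subset := Subset.rfl
  closed := by
    have h1 : IsClosed {s : WeakDual ℝ Y | ∀ k ∈ K, 0 ≤ s k} := by
      simp only [ofPred_forall]
      exact isClosed_iInter fun k => isClosed_iInter fun _ =>
        isClosed_le continuous_const (WeakDual.eval_continuous k)
    have h2 := WeakDual.isClosed_closedBall (𝕜 := ℝ) (0 : StrongDual ℝ Y) 1
    have h3 : (StrongDual.toWeakDual '' (positivePolar K ∩ Metric.closedBall 0 1) :
        Set (WeakDual ℝ Y)) = {s : WeakDual ℝ Y | ∀ k ∈ K, 0 ≤ s k} ∩
          WeakDual.toStrongDual ⁻¹' Metric.closedBall (0 : StrongDual ℝ Y) 1 := by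
      ext s
      constructor
      · rintro ⟨t, ht, rfl⟩
        exact ht
      · intro hs
        exact ⟨WeakDual.toStrongDual s, hs, rfl⟩
    unfold IsWeakStarClosed
    rw [h3]
    exact h1.inter h2
  feasible_iff := by
    intro x
    constructor
    · intro hx s hs
      have h := hs.1 _ hx
      rw [map_neg] at h
      exact neg_nonneg.mp h
    · intro h
      by_contra hx
      obtain ⟨s, hs, hs0⟩ := K.hyperplane_separation_point hx
      have hc : (0 : ℝ) < ‖s‖ + 1 := by positivity
      have hmem : (‖s‖ + 1)⁻¹ • s ∈ positivePolar K ∩ Metric.closedBall 0 1 := by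
        constructor
        · intro k hk
          have := hs k hk
          simp only [smul_apply, smul_eq_mul]
          positivity
        · rw [mem_closedBall_zero_iff, norm_smul, norm_inv, Real.norm_of_nonneg hc.le,
            inv_mul_le_iff₀ hc]
          linarith
      have h' := h _ hmem
      simp only [scalarization, smul_apply, smul_eq_mul] at h'
      rw [map_neg] at hs0
      have : 0 < (‖s‖ + 1)⁻¹ * s (g x) := mul_pos (inv_pos.mpr hc) (by linarith)
      linarith

end

/-! Write G = p ∘ g with p(y) = sup_{s ∈ T} s(y). This p is sublinear and nonpositive on -K, hence
monotone for the order of K, so G is convex and continuous. In a Clarke tangent direction of Ω at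
x̄, the sublinear functions f_i°(x̄; ·) + ξ_i‖·‖ and G°(x̄; ·) cannot all be negative: points of Ω
close to x̄ + t d would be feasible and better (`IsQuasiWeaklyPareto.exists_nonneg`). As the tangent
cone is convex, Hahn–Banach yields multipliers and linear functionals, below the corresponding
multiples, whose sum is nonnegative on the cone (`IsSublinear.exists_multipliers`). Condition (U)
keeps the objective multipliers from all vanishing, so they can be normalized to sum 1.

It remains to identify the functionals. Each objective part splits into a multiple of a Clarke
subgradient and a functional bounded by the norm (`IsSublinear.exists_add_eq`); minus the total is
normal to Ω. By convexity the constraint part is a subgradient of μG for some μ ≥ 0, and a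
separation in Y × ℝ factors it through g (`IsConeConvex.exists_linear_of_subgradient`): it is a
subgradient of ζ ∘ g for some linear ζ ≤ μp. This bound makes ζ continuous and nonnegative on K. All
these separations come from the sandwich theorem `IsSublinear.exists_linear_le_of_cone`. -/

/-! ### Sublinear functions and Hahn–Banach separation -/

/-- Positively homogeneous, subadditive real functions. -/
structure IsSublinear {E : Type*} [AddCommGroup E] [Module ℝ E] (p : E → ℝ) : Prop where
  map_smul : ∀ c : ℝ, 0 < c → ∀ x, p (c • x) = c * p x
  map_add_le : ∀ x y, p (x + y) ≤ p x + p y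

namespace IsSublinear

variable {E : Type*} [AddCommGroup E] [Module ℝ E] {p q : E → ℝ}

theorem map_zero (hp : IsSublinear p) : p 0 = 0 := by
  have := hp.map_smul 2 two_pos 0
  rw [smul_zero] at this
  linarith

theorem add (hp : IsSublinear p) (hq : IsSublinear q) : IsSublinear (fun x => p x + q x) where
  map_smul c hc x := by simp only [hp.map_smul c hc, hq.map_smul c hc]; ring
  map_add_le x y := by linarith [hp.map_add_le x y, hq.map_add_le x y]

theorem const_mul (hp : IsSublinear p) {a : ℝ} (ha : 0 ≤ a) : IsSublinear (fun x => a * p x) where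
  map_smul c hc x := by simp only [hp.map_smul c hc]; ring
  map_add_le x y := by
    simpa only [mul_add] using mul_le_mul_of_nonneg_left (hp.map_add_le x y) ha

theorem neg_le_map_neg (hp : IsSublinear p) (x : E) : -p x ≤ p (-x) := by
  have := hp.map_add_le x (-x)
  rw [add_neg_cancel, hp.map_zero] at this
  linarith

/-- **Hahn–Banach sandwich theorem**: if a sublinear function majorizes the second coordinate on a
convex cone of `E × ℝ`, then so does some linear functional below it. -/
theorem exists_linear_le_of_cone (hp : IsSublinear p) (S : ConvexCone ℝ (E × ℝ))
    (h0 : (0 : E × ℝ) ∈ S) (hS : ∀ w ∈ S, w.2 ≤ p w.1) :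
    ∃ l : E →ₗ[ℝ] ℝ, (∀ x, l x ≤ p x) ∧ ∀ w ∈ S, w.2 ≤ l w.1 := by
  -- Any linear l ≤ Q works: w = 0 gives l ≤ p, and z = -w.1 gives -l w.1 ≤ p 0 - w.2. The
  -- hypothesis `hS` bounds the infimum from below.
  let F : E → S → ℝ := fun z w => p (z + w.1.1) - w.1.2
  let Q : E → ℝ := fun z => ⨅ w : S, F z w
  have : Nonempty S := ⟨⟨0, h0⟩⟩
  have hbdd : ∀ z, BddBelow (range (F z)) := by
    intro z
    refine ⟨-p (-z), ?_⟩
    rintro _ ⟨w, rfl⟩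
    have h1 := hp.map_add_le (z + w.1.1) (-z)
    rw [add_neg_cancel_comm] at h1
    have h2 := hS w.1 w.2
    simp only [F]
    linarith
  have hle : ∀ z (w : S), Q z ≤ F z w := fun z w => ciInf_le (hbdd z) w
  have hsmul_le : ∀ c : ℝ, 0 < c → ∀ z, Q (c • z) ≤ c * Q z := by
    intro c hc z
    rw [← div_le_iff₀' hc]
    refine le_ciInf fun w => ?_
    rw [div_le_iff₀' hc]
    refine (hle _ ⟨c • w.1, S.smul_mem hc w.2⟩).trans_eq ?_
    simp only [F, Prod.smul_fst, Prod.smul_snd, ← smul_add, hp.map_smul c hc, smul_eq_mul]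
    ring
  have hQsmul : ∀ c : ℝ, 0 < c → ∀ z, Q (c • z) = c * Q z := by
    intro c hc z
    refine le_antisymm (hsmul_le c hc z) ?_
    have := hsmul_le c⁻¹ (inv_pos.2 hc) (c • z)
    rw [inv_smul_smul₀ hc.ne'] at this
    calc c * Q z ≤ c * (c⁻¹ * Q (c • z)) := mul_le_mul_of_nonneg_left this hc.le
      _ = Q (c • z) := mul_inv_cancel_left₀ hc.ne' _
  have hQadd : ∀ y z, Q (y + z) ≤ Q y + Q z := by
    intro y z
    refine le_ciInf_add_ciInf fun v w => ?_
    refine (hle _ ⟨v.1 + w.1, S.add_mem v.2 w.2⟩).trans ?_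
    have := hp.map_add_le (y + v.1.1) (z + w.1.1)
    rw [add_add_add_comm] at this
    simp only [F, Prod.fst_add, Prod.snd_add]
    linarith
  have hQ0 : Q 0 = 0 := IsSublinear.map_zero ⟨hQsmul, hQadd⟩
  obtain ⟨l, -, hl⟩ := exists_extension_of_le_sublinear (⊥ : E →ₗ.[ℝ] ℝ) Q hQsmul hQadd (by
    rintro ⟨x, hx⟩
    obtain rfl : x = 0 := (Submodule.mem_bot ℝ).1 hx
    exact (LinearPMap.map_zero _).trans_le hQ0.ge)
  refine ⟨l, fun x => (hl x).trans ((hle x ⟨0, h0⟩).trans_eq (by simp [F])), fun w hw => ?_⟩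
  have := (hl (-w.1)).trans (hle _ ⟨w, hw⟩)
  simp only [F, neg_add_cancel, hp.map_zero, map_neg] at this
  linarith

theorem exists_linear_le (hp : IsSublinear p) : ∃ l : E →ₗ[ℝ] ℝ, ∀ x, l x ≤ p x := by
  obtain ⟨l, hl, -⟩ := hp.exists_linear_le_of_cone ⟨{0}, by simp, by simp⟩ rfl (by
    rintro w (rfl : w = 0)
    exact hp.map_zero.ge)
  exact ⟨l, hl⟩

/-- A linear functional below a sum of sublinear functions splits accordingly. -/
theorem exists_add_eq (hp : IsSublinear p) (hq : IsSublinear q) (l : E →ₗ[ℝ] ℝ)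
    (hl : ∀ x, l x ≤ p x + q x) :
    ∃ a b : E →ₗ[ℝ] ℝ, (∀ x, a x ≤ p x) ∧ (∀ x, b x ≤ q x) ∧ l = a + b := by
  have hP : IsSublinear (fun z : E × E => p z.1 + q z.2) :=
    { map_smul := fun c hc z => by
        simp only [Prod.smul_fst, Prod.smul_snd, hp.map_smul c hc, hq.map_smul c hc]; ring
      map_add_le := fun y z => by
        have h1 := hp.map_add_le y.1 z.1
        have h2 := hq.map_add_le y.2 z.2
        simp only [Prod.fst_add, Prod.snd_add]
        linarith }
  -- The cone is the graph of l over the diagonal of E × E. There k ≥ l, and testing x and -x turns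
  -- this into equality.
  obtain ⟨k, hk, hk'⟩ := hP.exists_linear_le_of_cone
    ⟨range fun x => ((x, x), l x), by
      rintro c - _ ⟨x, rfl⟩
      exact ⟨c • x, by simp⟩, by
      rintro _ ⟨x, rfl⟩ _ ⟨y, rfl⟩
      exact ⟨x + y, by simp⟩⟩ ⟨0, by simp⟩ (by
      rintro _ ⟨x, rfl⟩
      exact hl x)
  have hkl : ∀ x, l x ≤ k (x, x) := fun x => hk' ((x, x), l x) ⟨x, rfl⟩
  refine ⟨k ∘ₗ LinearMap.inl ℝ E E, k ∘ₗ LinearMap.inr ℝ E E, fun x => ?_, fun x => ?_, ?_⟩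
  · simpa [hq.map_zero] using hk (x, 0)
  · simpa [hp.map_zero] using hk (0, x)
  · ext x
    have h1 := hkl x
    have h2 := hkl (-x)
    have h3 : k (-x, -x) = -k (x, x) := by rw [← map_neg, Prod.neg_mk]
    rw [h3, map_neg] at h2
    have h4 : k (x, x) = k (x, 0) + k (0, x) := by rw [← map_add]; simp
    simp only [LinearMap.add_apply, LinearMap.comp_apply, LinearMap.inl_apply,
      LinearMap.inr_apply]
    linarith

/-- **Multiplier rule** for finitely many sublinear functions whose maximum is nonnegative on a
convex cone. -/
theorem exists_multipliers {ι : Type*} [Fintype ι] [Nonempty ι] {p : ι → E → ℝ}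
    (hp : ∀ j, IsSublinear (p j)) (S : ConvexCone ℝ E) (h0 : (0 : E) ∈ S)
    (hS : ∀ d ∈ S, ∃ j, 0 ≤ p j d) :
    ∃ (a : ι → ℝ) (l : ι → E →ₗ[ℝ] ℝ), (∀ j, 0 ≤ a j) ∧ ∑ j, a j = 1 ∧
      (∀ j d, l j d ≤ a j * p j d) ∧ ∀ d ∈ S, 0 ≤ ∑ j, l j d := by
  classical
  -- The real coordinate added to each slot makes the multipliers visible: the value of a linear
  -- minorant at (0, 1) in slot j will be a j.
  let P : (ι → E × ℝ) → ℝ := fun z =>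
    Finset.univ.sup' Finset.univ_nonempty fun j => p j (z j).1 + (z j).2
  have hle : ∀ z j, p j (z j).1 + (z j).2 ≤ P z := fun z j =>
    Finset.le_sup' (fun j => p j (z j).1 + (z j).2) (Finset.mem_univ j)
  have hPle : ∀ z c, (∀ j, p j (z j).1 + (z j).2 ≤ c) → P z ≤ c := fun z c h =>
    Finset.sup'_le _ _ fun j _ => h j
  have hsmul_le : ∀ c : ℝ, 0 < c → ∀ z, P (c • z) ≤ c * P z := by
    intro c hc z
    refine hPle _ _ fun j => ?_
    simp only [Pi.smul_apply, Prod.smul_fst, Prod.smul_snd, (hp j).map_smul c hc, smul_eq_mul]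
    rw [← mul_add]
    exact mul_le_mul_of_nonneg_left (hle z j) hc.le
  have hP : IsSublinear P :=
    { map_smul := fun c hc z => by
        refine le_antisymm (hsmul_le c hc z) ?_
        have := hsmul_le c⁻¹ (inv_pos.2 hc) (c • z)
        rw [inv_smul_smul₀ hc.ne'] at this
        calc c * P z ≤ c * (c⁻¹ * P (c • z)) := mul_le_mul_of_nonneg_left this hc.le
          _ = P (c • z) := mul_inv_cancel_left₀ hc.ne' _
      map_add_le := fun y z => by
        refine hPle _ _ fun j => ?_
        have h1 := (hp j).map_add_le (y j).1 (z j).1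
        have h2 := hle y j
        have h3 := hle z j
        simp only [Pi.add_apply, Prod.fst_add, Prod.snd_add]
        linarith }
  obtain ⟨k, hk, hk'⟩ := hP.exists_linear_le_of_cone
    ⟨(fun d => ((fun _ => (d, 0), 0) : (ι → E × ℝ) × ℝ)) '' S, by
      rintro c hc _ ⟨x, hx, rfl⟩
      refine ⟨c • x, S.smul_mem hc hx, ?_⟩
      ext <;> simp, by
      rintro _ ⟨x, hx, rfl⟩ _ ⟨y, hy, rfl⟩
      refine ⟨x + y, S.add_mem hx hy, ?_⟩
      ext <;> simp⟩ ⟨0, h0, rfl⟩ (by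
      rintro _ ⟨d, hd, rfl⟩
      obtain ⟨j, hj⟩ := hS d hd
      exact hj.trans (by simpa using hle (fun _ => (d, 0)) j))
  have hsum : ∀ z, k z = ∑ j, k (Pi.single j (z j)) := fun z => by
    rw [← map_sum, Finset.univ_sum_single]
  have hsplit : ∀ j d r, k (Pi.single j (d, r)) =
      k (Pi.single j (d, 0)) + r * k (Pi.single j (0, 1)) := by
    intro j d r
    rw [← smul_eq_mul, ← _root_.map_smul, ← map_add, ← Pi.single_smul, ← Pi.single_add]
    simp
  -- The other slots contribute p i 0 + 0 = 0 to the maximum. The choice (0, -1) will give a j ≥ 0,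
  -- and (d, -p j d) will give l j d ≤ a j * p j d.
  have hsingle : ∀ j d r, p j d + r ≤ 0 → k (Pi.single j (d, r)) ≤ 0 := by
    intro j d r h
    refine (hk _).trans (hPle _ _ fun i => ?_)
    rcases eq_or_ne i j with rfl | hij
    · simpa using h
    · simp [hij, (hp i).map_zero]
  refine ⟨fun j => k (Pi.single j (0, 1)),
    fun j => k ∘ₗ LinearMap.single ℝ (fun _ => E × ℝ) j ∘ₗ LinearMap.inl ℝ E ℝ,
    fun j => ?_, ?_, fun j d => ?_, fun d hd => ?_⟩
  · have h1 := hsingle j 0 (-1) (by simp [(hp j).map_zero])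
    rw [hsplit, show ((0 : E), (0 : ℝ)) = 0 from rfl, Pi.single_zero, _root_.map_zero] at h1
    linarith
  · have h1 : k (fun _ => (0, 1)) ≤ 1 :=
      (hk _).trans (hPle _ _ fun j => by simp [(hp j).map_zero])
    have h2 : k (-fun _ => (0, 1)) ≤ -1 :=
      (hk _).trans (hPle _ _ fun j => by simp [(hp j).map_zero])
    rw [map_neg] at h2
    rw [← hsum fun _ => (0, 1)]
    linarith
  · have h1 := hsingle j d (-p j d) (by simp)
    rw [hsplit] at h1
    simp only [LinearMap.comp_apply, LinearMap.inl_apply, LinearMap.coe_single]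
    linarith
  · have h1 := hk' _ ⟨d, hd, rfl⟩
    rw [hsum] at h1
    exact h1

end IsSublinear

/-! ### Clarke derivatives, subgradients and tangent cones -/

section ClarkeCalculus

variable {X : Type*} [NormedAddCommGroup X]

theorem tendsto_prodMk_clarke (x : X) :
    Tendsto (fun t : ℝ => (x, t)) (𝓝[>] 0) (𝓝 x ×ˢ 𝓝[>] (0 : ℝ)) :=
  Tendsto.prodMk tendsto_const_nhds tendsto_id

theorem eventually_snd_pos_clarke (x : X) :
    ∀ᶠ p : X × ℝ in 𝓝 x ×ˢ 𝓝[>] (0 : ℝ), 0 < p.2 :=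
  tendsto_snd.eventually eventually_mem_nhdsWithin

theorem locallyLipschitz_infDist (S : Set X) : LocallyLipschitz fun x => Metric.infDist x S :=
  (Metric.lipschitz_infDist_pt S).locallyLipschitz

variable [NormedSpace ℝ X] {φ : X → ℝ} {xbar d : X}

theorem tendsto_add_smul_clarke (x d : X) :
    Tendsto (fun p : X × ℝ => p.1 + p.2 • d) (𝓝 x ×ˢ 𝓝[>] (0 : ℝ)) (𝓝 x) := by
  have h1 : Tendsto (fun p : X × ℝ => p.1) (𝓝 x ×ˢ 𝓝[>] (0 : ℝ)) (𝓝 x) := tendsto_fst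
  have h2 : Tendsto (fun p : X × ℝ => p.2) (𝓝 x ×ˢ 𝓝[>] (0 : ℝ)) (𝓝 0) :=
    tendsto_snd.mono_right nhdsWithin_le_nhds
  simpa using h1.add (h2.smul_const d)

/-- This two-sided bound makes the real limsup a genuine one, and it later gives the continuity of
linear functionals below the Clarke derivative. -/
theorem LocallyLipschitz.exists_eventually_abs_quotient_le (hφ : LocallyLipschitz φ) (x : X) :
    ∃ L : ℝ, 0 ≤ L ∧ ∀ d, ∀ᶠ p : X × ℝ in 𝓝 x ×ˢ 𝓝[>] (0 : ℝ),
      |(φ (p.1 + p.2 • d) - φ p.1) / p.2| ≤ L * ‖d‖ := by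
  obtain ⟨L, U, hU, hL⟩ := hφ x
  refine ⟨L, L.2, fun d => ?_⟩
  filter_upwards [(tendsto_add_smul_clarke x d).eventually hU, tendsto_fst.eventually hU,
    eventually_snd_pos_clarke x] with p h1 h2 h3
  rw [abs_div, abs_of_pos h3, div_le_iff₀ h3]
  have := hL.dist_le_mul _ h1 _ h2
  rw [Real.dist_eq, dist_eq_norm, add_sub_cancel_left, norm_smul, Real.norm_of_nonneg h3.le] at this
  linarith

theorem LocallyLipschitz.isBoundedUnder_quotient (hφ : LocallyLipschitz φ) (x d : X) :
    IsBoundedUnder (· ≤ ·) (𝓝 x ×ˢ 𝓝[>] (0 : ℝ))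
      (fun p : X × ℝ => (φ (p.1 + p.2 • d) - φ p.1) / p.2) := by
  obtain ⟨L, -, hL⟩ := hφ.exists_eventually_abs_quotient_le x
  exact ⟨L * ‖d‖, eventually_map.2 ((hL d).mono fun p hp => (le_abs_self _).trans hp)⟩

theorem LocallyLipschitz.isCoboundedUnder_quotient (hφ : LocallyLipschitz φ) (x d : X) :
    IsCoboundedUnder (· ≤ ·) (𝓝 x ×ˢ 𝓝[>] (0 : ℝ))
      (fun p : X × ℝ => (φ (p.1 + p.2 • d) - φ p.1) / p.2) := by
  obtain ⟨L, -, hL⟩ := hφ.exists_eventually_abs_quotient_le x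
  have : IsBoundedUnder (· ≥ ·) (𝓝 x ×ˢ 𝓝[>] (0 : ℝ))
      (fun p : X × ℝ => (φ (p.1 + p.2 • d) - φ p.1) / p.2) :=
    ⟨-(L * ‖d‖), eventually_map.2 ((hL d).mono fun p hp => (abs_le.1 hp).1)⟩
  exact this.isCoboundedUnder_le

theorem LocallyLipschitz.eventually_quotient_lt (hφ : LocallyLipschitz φ) {c : ℝ}
    (hc : clarkeDeriv φ xbar d < c) :
    ∀ᶠ p : X × ℝ in 𝓝 xbar ×ˢ 𝓝[>] (0 : ℝ), (φ (p.1 + p.2 • d) - φ p.1) / p.2 < c :=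
  eventually_lt_of_limsup_lt hc (hφ.isBoundedUnder_quotient xbar d)

theorem LocallyLipschitz.clarkeDeriv_le (hφ : LocallyLipschitz φ) {c : ℝ}
    (hc : ∀ᶠ p : X × ℝ in 𝓝 xbar ×ˢ 𝓝[>] (0 : ℝ), (φ (p.1 + p.2 • d) - φ p.1) / p.2 ≤ c) :
    clarkeDeriv φ xbar d ≤ c :=
  limsup_le_of_le (hφ.isCoboundedUnder_quotient xbar d) hc

theorem LocallyLipschitz.exists_clarkeDeriv_le (hφ : LocallyLipschitz φ) (x : X) :
    ∃ L : ℝ, 0 ≤ L ∧ ∀ d, clarkeDeriv φ x d ≤ L * ‖d‖ := by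
  obtain ⟨L, hL0, hL⟩ := hφ.exists_eventually_abs_quotient_le x
  exact ⟨L, hL0, fun d => hφ.clarkeDeriv_le ((hL d).mono fun p hp => (le_abs_self _).trans hp)⟩

/-- The Clarke derivative of a locally Lipschitz function is sublinear in the direction. -/
theorem LocallyLipschitz.isSublinear_clarkeDeriv (hφ : LocallyLipschitz φ) (x : X) :
    IsSublinear (clarkeDeriv φ x) := by
  have hsmul_le : ∀ c : ℝ, 0 < c → ∀ d, clarkeDeriv φ x (c • d) ≤ c * clarkeDeriv φ x d := by
    intro c hc d
    rw [← div_le_iff₀' hc]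
    refine le_of_forall_gt_imp_ge_of_dense fun r hr => ?_
    rw [div_le_iff₀' hc]
    refine hφ.clarkeDeriv_le ?_
    have ht : Tendsto (fun p : X × ℝ => (p.1, c * p.2)) (𝓝 x ×ˢ 𝓝[>] (0 : ℝ))
        (𝓝 x ×ˢ 𝓝[>] (0 : ℝ)) := by
      refine Tendsto.prodMk tendsto_fst (tendsto_nhdsWithin_iff.2 ⟨?_, ?_⟩)
      · have : Tendsto (fun p : X × ℝ => p.2) (𝓝 x ×ˢ 𝓝[>] (0 : ℝ)) (𝓝 0) :=
          tendsto_snd.mono_right nhdsWithin_le_nhds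
        simpa using this.const_mul c
      · exact (eventually_snd_pos_clarke x).mono fun p hp => mul_pos hc hp
    filter_upwards [ht.eventually (hφ.eventually_quotient_lt hr), eventually_snd_pos_clarke x]
      with p h1 h2
    rw [div_lt_iff₀ (mul_pos hc h2)] at h1
    rw [div_le_iff₀ h2, smul_smul, mul_comm p.2 c]
    linarith
  refine ⟨fun c hc d => le_antisymm (hsmul_le c hc d) ?_, fun d e => ?_⟩
  · have := hsmul_le c⁻¹ (inv_pos.2 hc) (c • d)
    rw [inv_smul_smul₀ hc.ne'] at this
    calc c * clarkeDeriv φ x d ≤ c * (c⁻¹ * clarkeDeriv φ x (c • d)) :=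
          mul_le_mul_of_nonneg_left this hc.le
      _ = clarkeDeriv φ x (c • d) := mul_inv_cancel_left₀ hc.ne' _
  · refine le_of_forall_pos_le_add fun ε hε => hφ.clarkeDeriv_le ?_
    -- The quotient in direction d + e is the quotient in direction d plus the one in direction e at
    -- the shifted base point x + t d; the limsup over moving base points absorbs the shift.
    have ht : Tendsto (fun p : X × ℝ => (p.1 + p.2 • d, p.2)) (𝓝 x ×ˢ 𝓝[>] (0 : ℝ))
        (𝓝 x ×ˢ 𝓝[>] (0 : ℝ)) := (tendsto_add_smul_clarke x d).prodMk tendsto_snd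
    have hd : clarkeDeriv φ x d < clarkeDeriv φ x d + ε / 2 := by linarith
    have he : clarkeDeriv φ x e < clarkeDeriv φ x e + ε / 2 := by linarith
    filter_upwards [hφ.eventually_quotient_lt hd, ht.eventually (hφ.eventually_quotient_lt he),
      eventually_snd_pos_clarke x] with p h1 h2 h3
    rw [div_lt_iff₀ h3] at h1 h2
    rw [div_le_iff₀ h3, smul_add, ← add_assoc]
    linarith

/-- Linear functionals below a multiple of the Clarke derivative are multiples of Clarke
subgradients. -/
theorem LocallyLipschitz.exists_mem_smul_clarkeSubdiff (hφ : LocallyLipschitz φ) {a : ℝ}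
    (ha : 0 ≤ a) (l : X →ₗ[ℝ] ℝ) (hl : ∀ d, l d ≤ a * clarkeDeriv φ xbar d) :
    ∃ k ∈ a • clarkeSubdiff φ xbar, ∀ d, k d = l d := by
  obtain ⟨L, hL0, hL⟩ := hφ.exists_clarkeDeriv_le xbar
  have key : ∀ k : X →ₗ[ℝ] ℝ, (∀ d, k d ≤ clarkeDeriv φ xbar d) →
      ∃ k' ∈ clarkeSubdiff φ xbar, ∀ d, k' d = k d := by
    intro k hk
    have hk' : ∀ d, ‖k d‖ ≤ L * ‖d‖ := fun d => abs_le'.2 ⟨(hk d).trans (hL d), by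
      simpa using (hk (-d)).trans (hL (-d))⟩
    exact ⟨k.mkContinuous L hk', hk, fun d => rfl⟩
  -- For a = 0 the functional l vanishes, but 0 lies in 0 • ∂φ only because ∂φ is nonempty, again by
  -- Hahn–Banach.
  rcases ha.eq_or_lt with rfl | ha
  · obtain ⟨k, hk⟩ := (hφ.isSublinear_clarkeDeriv xbar).exists_linear_le
    obtain ⟨k', hk', -⟩ := key k hk
    refine ⟨0, ⟨k', hk', zero_smul ℝ k'⟩, fun d => ?_⟩
    have h1 := hl d
    have h2 := hl (-d)
    rw [map_neg] at h2
    change 0 = l d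
    linarith
  · obtain ⟨k, hk, hkl⟩ := key (a⁻¹ • l) fun d => by
      rw [LinearMap.smul_apply, smul_eq_mul, inv_mul_le_iff₀ ha]
      exact hl d
    refine ⟨a • k, smul_mem_smul_set hk, fun d => ?_⟩
    rw [smul_apply, hkl, LinearMap.smul_apply, smul_inv_smul₀ ha.ne']

/-- A bound on the Clarke derivative controls the function along curves that are almost tangent to
the direction. -/
theorem LocallyLipschitz.eventually_lt_of_clarkeDeriv_lt (hφ : LocallyLipschitz φ) {c : ℝ}
    (hc : clarkeDeriv φ xbar d < c) :
    ∀ᶠ ε in 𝓝[>] (0 : ℝ), ∀ᶠ t in 𝓝[>] (0 : ℝ),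
      ∀ y, ‖y - (xbar + t • d)‖ ≤ ε * t → φ y < φ xbar + t * c := by
  -- The gap c - b pays for the Lipschitz error L ε t of replacing x̄ + t d by y.
  obtain ⟨b, hb, hbc⟩ := exists_between hc
  obtain ⟨L, U, hU, hL⟩ := hφ xbar
  have hε : ∀ᶠ ε in 𝓝[>] (0 : ℝ), L * ε < c - b := by
    have : Tendsto (fun ε : ℝ => L * ε) (𝓝[>] 0) (𝓝 (L * 0)) :=
      (tendsto_id.mono_left nhdsWithin_le_nhds).const_mul _
    exact this.eventually (gt_mem_nhds (by rw [mul_zero]; linarith))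
  filter_upwards [hε, eventually_mem_nhdsWithin] with ε hε hε0
  obtain ⟨r, hr, hrU⟩ := Metric.mem_nhds_iff.1 hU
  have ht : ∀ᶠ t in 𝓝[>] (0 : ℝ), t * (‖d‖ + ε) < r := by
    have : Tendsto (fun t : ℝ => t * (‖d‖ + ε)) (𝓝[>] 0) (𝓝 (0 * (‖d‖ + ε))) :=
      (tendsto_id.mono_left nhdsWithin_le_nhds).mul_const _
    exact this.eventually (gt_mem_nhds (by rwa [zero_mul]))
  filter_upwards [ht, eventually_mem_nhdsWithin,
    (tendsto_prodMk_clarke xbar).eventually (hφ.eventually_quotient_lt hb)] with t h1 h2 h3 y hy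
  have h2 : 0 < t := h2
  have hε0 : 0 < ε := hε0
  have hn : ‖t • d‖ = t * ‖d‖ := by rw [norm_smul, Real.norm_of_nonneg h2.le]
  have hεt := mul_pos hε0 h2
  have m1 : xbar + t • d ∈ U := hrU (by
    rw [mem_ball_iff_norm, add_sub_cancel_left, hn]
    linarith)
  have m2 : y ∈ U := hrU (by
    rw [mem_ball_iff_norm]
    have := norm_add_le (y - (xbar + t • d)) (t • d)
    rw [sub_add_eq_sub_sub, sub_add_cancel, ← sub_add_eq_sub_sub] at this
    linarith)
  have h4 := (le_abs_self _).trans (hL.dist_le_mul _ m2 _ m1)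
  rw [dist_eq_norm] at h4
  have h5 := mul_le_mul_of_nonneg_left hy L.2
  rw [div_lt_iff₀ h2] at h3
  have h6 := mul_lt_mul_of_pos_right hε h2
  change (L : ℝ) * ‖y - (xbar + t • d)‖ ≤ L * (ε * t) at h5
  linarith

/-! ### Convex functions -/

/-- For 0 < t < 1 convexity bounds the quotient at x by φ (x + d) - φ x, which is continuous in x.
-/
theorem ConvexOn.clarkeDeriv_le_sub (hφ : ConvexOn ℝ univ φ) (hφc : Continuous φ) (xbar d : X) :
    clarkeDeriv φ xbar d ≤ φ (xbar + d) - φ xbar := by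
  have hlip : LocallyLipschitz φ := locallyLipschitzOn_univ.1
    ((hφ.locallyLipschitzOn_iff_continuousOn isOpen_univ).2 hφc.continuousOn)
  refine le_of_forall_gt_imp_ge_of_dense fun r hr => hlip.clarkeDeriv_le ?_
  have h1 : ∀ᶠ p : X × ℝ in 𝓝 xbar ×ˢ 𝓝[>] (0 : ℝ), φ (p.1 + d) - φ p.1 < r := by
    have : ContinuousAt (fun x => φ (x + d) - φ x) xbar := by fun_prop
    exact tendsto_fst.eventually (this.eventually (gt_mem_nhds hr))
  have h2 : ∀ᶠ p : X × ℝ in 𝓝 xbar ×ˢ 𝓝[>] (0 : ℝ), p.2 < 1 :=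
    tendsto_snd.eventually (nhdsWithin_le_nhds (gt_mem_nhds one_pos))
  filter_upwards [h1, h2, eventually_snd_pos_clarke xbar] with p h1 h2 h3
  rw [div_le_iff₀ h3]
  have h4 := hφ.2 (mem_univ (p.1 + d)) (mem_univ p.1) h3.le (sub_nonneg.2 h2.le)
    (add_sub_cancel p.2 1)
  have h5 : p.2 • (p.1 + d) + (1 - p.2) • p.1 = p.1 + p.2 • d := by module
  rw [h5, smul_eq_mul, smul_eq_mul] at h4
  have h6 := mul_lt_mul_of_pos_right h1 h3
  linarith

/-- Subgradients in the sense of convex analysis are Clarke subgradients. -/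
theorem LocallyLipschitz.mem_clarkeSubdiff_of_le_sub (hφ : LocallyLipschitz φ)
    (l : StrongDual ℝ X) (hl : ∀ x, l (x - xbar) ≤ φ x - φ xbar) :
    l ∈ clarkeSubdiff φ xbar := by
  intro d
  by_contra! h
  obtain ⟨t, h1, h2⟩ := (((tendsto_prodMk_clarke xbar).eventually
    (hφ.eventually_quotient_lt h)).and eventually_mem_nhdsWithin).exists
  have h2 : 0 < t := h2
  have h3 := hl (xbar + t • d)
  rw [add_sub_cancel_left, map_smul, smul_eq_mul] at h3
  rw [div_lt_iff₀ h2] at h1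
  dsimp only at h1
  linarith

/-! ### The Clarke tangent cone -/

/-- The distance vanishes at a point of S, so quotients based there are nonnegative and the
derivative cannot be negative. The inequality form makes convexity of the cone follow from
subadditivity. -/
theorem mem_clarkeTangentCone_iff {S : Set X} (hx : xbar ∈ S) :
    d ∈ clarkeTangentCone S xbar ↔ clarkeDeriv (fun x => Metric.infDist x S) xbar d ≤ 0 := by
  refine ⟨fun h => le_of_eq h, fun h => le_antisymm h ?_⟩
  by_contra! h'
  obtain ⟨t, h1, h2⟩ := (((tendsto_prodMk_clarke xbar).eventually
    ((locallyLipschitz_infDist S).eventually_quotient_lt h')).and eventually_mem_nhdsWithin).exists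
  have h2 : 0 < t := h2
  rw [div_lt_iff₀ h2, Metric.infDist_zero_of_mem hx] at h1
  have := Metric.infDist_nonneg (x := xbar + t • d) (s := S)
  dsimp only at h1
  linarith

theorem exists_convexCone_coe_eq_clarkeTangentCone {S : Set X} (hx : xbar ∈ S) :
    ∃ C : ConvexCone ℝ X, (0 : X) ∈ C ∧ ∀ d, d ∈ C ↔ d ∈ clarkeTangentCone S xbar := by
  have hs := (locallyLipschitz_infDist S).isSublinear_clarkeDeriv xbar
  refine ⟨⟨clarkeTangentCone S xbar, fun c hc v hv => ?_, fun v hv w hw => ?_⟩, hs.map_zero,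
    fun d => Iff.rfl⟩
  · change _ = _ at hv
    change _ = _
    rw [hs.map_smul c hc, hv, mul_zero]
  · rw [mem_clarkeTangentCone_iff hx] at hv hw ⊢
    linarith [hs.map_add_le v w]

theorem eventually_exists_mem_norm_sub_le {S : Set X} (hx : xbar ∈ S)
    (hd : d ∈ clarkeTangentCone S xbar) {ε : ℝ} (hε : 0 < ε) :
    ∀ᶠ t in 𝓝[>] (0 : ℝ), ∃ y ∈ S, ‖y - (xbar + t • d)‖ ≤ ε * t := by
  filter_upwards [(tendsto_prodMk_clarke xbar).eventually
    ((locallyLipschitz_infDist S).eventually_quotient_lt (lt_of_eq_of_lt hd hε)),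
    eventually_mem_nhdsWithin] with t h1 h2
  rw [div_lt_iff₀ h2, Metric.infDist_zero_of_mem hx, sub_zero,
    Metric.infDist_lt_iff ⟨xbar, hx⟩] at h1
  obtain ⟨y, hy, h⟩ := h1
  rw [dist_comm, dist_eq_norm] at h
  exact ⟨y, hy, h.le⟩

end ClarkeCalculus

/-! ### Cone-convex maps and monotone sublinear functions -/

section ConeConvex

variable {X : Type*} [NormedAddCommGroup X] [NormedSpace ℝ X]
  {Y : Type*} [NormedAddCommGroup Y] [NormedSpace ℝ Y]
  {K : ProperCone ℝ Y} {g : X → Y} {p : Y → ℝ}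

theorem IsSublinear.map_le_of_sub_mem (hp : IsSublinear p) (hpK : ∀ k ∈ K, p (-k) ≤ 0) {y z : Y}
    (h : z - y ∈ K) : p y ≤ p z := by
  have h1 := hp.map_add_le z (-(z - y))
  rw [neg_sub, add_sub_cancel] at h1
  have h2 := hpK _ h
  rw [neg_sub] at h2
  linarith

theorem IsConeConvex.sub_mem (hgK : IsConeConvex K g) (x y : X) {a b : ℝ} (ha : 0 ≤ a)
    (hb : 0 ≤ b) (hab : a + b = 1) : a • g x + b • g y - g (a • x + b • y) ∈ K := by
  obtain rfl : b = 1 - a := by linarith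
  have := hgK x y a ⟨ha, by linarith⟩
  convert this using 1
  abel

theorem IsConeConvex.convexOn_comp (hgK : IsConeConvex K g) (hp : IsSublinear p)
    (hpK : ∀ k ∈ K, p (-k) ≤ 0) : ConvexOn ℝ univ fun x => p (g x) := by
  have hsmul : ∀ a : ℝ, 0 ≤ a → ∀ y, p (a • y) = a * p y := by
    intro a ha y
    rcases ha.eq_or_lt with rfl | ha
    · rw [zero_smul, zero_mul, hp.map_zero]
    · exact hp.map_smul a ha y
  refine ⟨convex_univ, fun x _ y _ a b ha hb hab => ?_⟩
  have h1 := hp.map_le_of_sub_mem hpK (hgK.sub_mem x y ha hb hab)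
  have h2 := hp.map_add_le (a • g x) (b • g y)
  rw [hsmul a ha, hsmul b hb] at h2
  exact h1.trans h2

theorem IsSublinear.continuous_of_le_norm (hp : IsSublinear p) {C : ℝ} (hC : 0 ≤ C)
    (hle : ∀ y, p y ≤ C * ‖y‖) : Continuous p := by
  refine (LipschitzWith.of_le_add_mul (K := ⟨C, hC⟩) fun y z => ?_).continuous
  have h1 := hp.map_add_le z (y - z)
  rw [add_sub_cancel] at h1
  have h2 := hle (y - z)
  rw [dist_eq_norm]
  change _ ≤ p z + C * _
  linarith

/-- Chain rule for a monotone sublinear function composed with a cone-convex map. -/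
theorem IsConeConvex.exists_linear_of_subgradient (hgK : IsConeConvex K g) (hp : IsSublinear p)
    (hpK : ∀ k ∈ K, p (-k) ≤ 0) {xbar : X} (l : X →ₗ[ℝ] ℝ)
    (hl : ∀ x, l (x - xbar) ≤ p (g x) - p (g xbar)) :
    ∃ ζ : Y →ₗ[ℝ] ℝ, (∀ y, ζ y ≤ p y) ∧ ∀ x, l (x - xbar) ≤ ζ (g x) - ζ (g xbar) := by
  -- This is the cone generated by the points (g x + k, r) with k ∈ K and r ≤ p (g x̄) + l (x - x̄),
  -- together with K × (-∞, 0]. Cone-convexity of g makes it convex; monotonicity of p and the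
  -- subgradient inequality put it below the graph of p.
  let S : ConvexCone ℝ (Y × ℝ) :=
    { carrier := {w | ∃ t : ℝ, 0 ≤ t ∧ ∃ x : X, w.1 - t • g x ∈ K ∧
        w.2 ≤ t * (p (g xbar) + l (x - xbar))}
      smul_mem' := by
        rintro c hc w ⟨t, ht, x, h1, h2⟩
        refine ⟨c * t, mul_nonneg hc.le ht, x, ?_, ?_⟩
        · rw [Prod.smul_fst, mul_smul, ← smul_sub]
          exact K.smul_mem h1 hc.le
        · rw [Prod.smul_snd, smul_eq_mul, mul_assoc]
          exact mul_le_mul_of_nonneg_left h2 hc.le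
      add_mem' := by
        rintro v ⟨s, hs, x, h1, h2⟩ w ⟨t, ht, y, h3, h4⟩
        -- The sum is represented at the average of x and y with weights s and t, which needs s + t
        -- ≠ 0.
        rcases (add_nonneg hs ht).eq_or_lt with h0 | h0
        · obtain rfl : s = 0 := by linarith
          obtain rfl : t = 0 := by linarith
          refine ⟨0, le_rfl, x, ?_, ?_⟩
          · simpa using K.add_mem h1 h3
          · simpa using add_nonpos (by simpa using h2) (by simpa using h4)
        · have hst : (s + t) * (s / (s + t)) = s := mul_div_cancel₀ _ h0.ne'
          have hts : (s + t) * (t / (s + t)) = t := mul_div_cancel₀ _ h0.ne'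
          have hone : s / (s + t) + t / (s + t) = 1 := by rw [← add_div, div_self h0.ne']
          refine ⟨s + t, h0.le, (s / (s + t)) • x + (t / (s + t)) • y, ?_, ?_⟩
          · have h5 := K.smul_mem (hgK.sub_mem x y (div_nonneg hs h0.le) (div_nonneg ht h0.le)
              hone) h0.le
            rw [smul_sub, smul_add, smul_smul, smul_smul, hst, hts] at h5
            have h6 : _ ∈ K := K.add_mem (K.add_mem h1 h3) h5
            convert h6 using 1
            rw [Prod.fst_add]
            abel
          · have h5 : (s / (s + t)) • x + (t / (s + t)) • y - xbar =
                (s / (s + t)) • (x - xbar) + (t / (s + t)) • (y - xbar) := by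
              conv_lhs => rw [← one_smul ℝ xbar, ← hone]
              module
            rw [h5, map_add, map_smul, map_smul, smul_eq_mul, smul_eq_mul, Prod.snd_add]
            have h6 : (s + t) * (p (g xbar) + (s / (s + t) * l (x - xbar) +
                t / (s + t) * l (y - xbar))) = (s + t) * p (g xbar) +
                ((s + t) * (s / (s + t))) * l (x - xbar) +
                ((s + t) * (t / (s + t))) * l (y - xbar) := by ring
            rw [h6, hst, hts]
            linarith }
  obtain ⟨ζ, h1, h2⟩ := hp.exists_linear_le_of_cone S ⟨0, le_rfl, xbar, by simp, by simp⟩ (by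
    rintro w ⟨t, ht, x, h1, h2⟩
    have h3 := hp.map_le_of_sub_mem hpK h1
    have h4 : p (t • g x) = t * p (g x) := by
      rcases ht.eq_or_lt with rfl | ht
      · rw [zero_smul, zero_mul, hp.map_zero]
      · exact hp.map_smul t ht _
    have h5 := mul_le_mul_of_nonneg_left (hl x) ht
    linarith)
  refine ⟨ζ, h1, fun x => ?_⟩
  have h3 := h2 (g x, p (g xbar) + l (x - xbar)) ⟨1, zero_le_one, x, by simp, by simp⟩
  have h4 := h1 (g xbar)
  dsimp only at h3
  linarith

theorem mem_clarkeSubdiff_scalarization (hg : Continuous g) (hgK : IsConeConvex K g)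
    {ζ : StrongDual ℝ Y} (hζ : ζ ∈ positivePolar K) {xbar : X} {l : StrongDual ℝ X}
    (hl : ∀ x, l (x - xbar) ≤ ζ (g x) - ζ (g xbar)) :
    l ∈ clarkeSubdiff (scalarization g ζ) xbar := by
  have hconv : ConvexOn ℝ univ (scalarization g ζ) :=
    hgK.convexOn_comp (p := ζ) ⟨fun c _ x => by simp, fun x y => by simp⟩
      fun k hk => by simpa using hζ k hk
  have hcont : Continuous (scalarization g ζ) := ζ.continuous.comp hg
  exact (locallyLipschitzOn_univ.1 ((hconv.locallyLipschitzOn_iff_continuousOn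
    isOpen_univ).2 hcont.continuousOn)).mem_clarkeSubdiff_of_le_sub l hl

end ConeConvex

/-! ### Support functions of sets of functionals -/

section SupportFunction

variable {Y : Type*} [NormedAddCommGroup Y] [NormedSpace ℝ Y] {T : Set (StrongDual ℝ Y)}

/-- The support function of a set of functionals. -/
noncomputable def dualSupport (T : Set (StrongDual ℝ Y)) (y : Y) : ℝ :=
  sSup ((fun s : StrongDual ℝ Y => s y) '' T)

theorem apply_le_norm_of_subset_closedBall (hT : T ⊆ Metric.closedBall 0 1) {s : StrongDual ℝ Y}
    (hs : s ∈ T) (y : Y) : s y ≤ ‖y‖ :=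
  (le_abs_self _).trans ((s.le_of_opNorm_le (mem_closedBall_zero_iff.1 (hT hs)) y).trans_eq
    (one_mul _))

theorem apply_le_dualSupport (hT : T ⊆ Metric.closedBall 0 1) {s : StrongDual ℝ Y} (hs : s ∈ T)
    (y : Y) : s y ≤ dualSupport T y :=
  le_csSup ⟨‖y‖, by
    rintro _ ⟨r, hr, rfl⟩
    exact apply_le_norm_of_subset_closedBall hT hr y⟩ ⟨s, hs, rfl⟩

theorem dualSupport_le (hne : T.Nonempty) {y : Y} {c : ℝ} (h : ∀ s ∈ T, s y ≤ c) :
    dualSupport T y ≤ c :=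
  csSup_le (hne.image _) (by
    rintro _ ⟨s, hs, rfl⟩
    exact h s hs)

theorem isSublinear_dualSupport (hT : T ⊆ Metric.closedBall 0 1) (hne : T.Nonempty) :
    IsSublinear (dualSupport T) where
  map_smul c hc y := by
    refine le_antisymm (dualSupport_le hne fun s hs => ?_) ?_
    · rw [map_smul, smul_eq_mul]
      exact mul_le_mul_of_nonneg_left (apply_le_dualSupport hT hs y) hc.le
    · rw [← le_div_iff₀' hc]
      refine dualSupport_le hne fun s hs => ?_
      rw [le_div_iff₀' hc]
      simpa using apply_le_dualSupport hT hs (c • y)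
  map_add_le y z := dualSupport_le hne fun s hs => by
    rw [map_add]
    exact add_le_add (apply_le_dualSupport hT hs y) (apply_le_dualSupport hT hs z)

end SupportFunction

/-! ### Absence of common descent directions -/

section Optimality

variable {X : Type*} [NormedAddCommGroup X] [NormedSpace ℝ X]
  {Y : Type*} [NormedAddCommGroup Y] [NormedSpace ℝ Y]
  {K : ProperCone ℝ Y} {g : X → Y} {T : Set (StrongDual ℝ Y)}

/-- Since `sSup ∅ = 0` in ℝ, an empty T makes G identically zero; so (U) forces T to be nonempty. -/
theorem clarkeDeriv_supFun_empty (xbar d : X) :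
    clarkeDeriv (supFun g (∅ : Set (StrongDual ℝ Y))) xbar d = 0 := by
  simp [clarkeDeriv, supFun]

/-- A common descent direction of the perturbed objectives and of the constraint function that is
tangent to `Ω` contradicts quasi-weak Pareto optimality. -/
theorem IsQuasiWeaklyPareto.exists_nonneg {m : ℕ} {f : Fin m → X → ℝ}
    (hf : ∀ i, LocallyLipschitz (f i)) {Ω : Set X} {ξ : Fin m → ℝ} (hξ : ∀ i, 0 ≤ ξ i) {xbar : X}
    (hx : IsQuasiWeaklyPareto f (coneFeasible Ω K g) ξ xbar) (hT : IsIndexSet K g T)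
    (hne : T.Nonempty) (hG : LocallyLipschitz (supFun g T)) {d : X}
    (hd : d ∈ clarkeTangentCone Ω xbar) :
    (∃ i, 0 ≤ clarkeDeriv (f i) xbar d + ξ i * ‖d‖) ∨ 0 ≤ clarkeDeriv (supFun g T) xbar d := by
  by_contra! h
  obtain ⟨hobj, hcon⟩ := h
  have hxΩ : xbar ∈ Ω := hx.1.1
  have hball : T ⊆ Metric.closedBall 0 1 := hT.subset.trans inter_subset_right
  have hGx : supFun g T xbar ≤ 0 := dualSupport_le hne ((hT.feasible_iff xbar).1 hx.1.2)
  -- The strict gap leaves room for the penalty at y, which is at most t * ξ i * (‖d‖ + ε) rather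
  -- than t * ξ i * ‖d‖.
  have hmid : ∀ i, ∃ c, clarkeDeriv (f i) xbar d < c ∧ c < -(ξ i * ‖d‖) := fun i =>
    exists_between (by linarith [hobj i])
  choose c hc hcξ using hmid
  have hsmall : ∀ i, ∀ᶠ ε in 𝓝[>] (0 : ℝ), c i + ξ i * (‖d‖ + ε) < 0 := fun i => by
    have : Tendsto (fun ε : ℝ => c i + ξ i * (‖d‖ + ε)) (𝓝[>] 0)
        (𝓝 (c i + ξ i * (‖d‖ + 0))) :=
      (((tendsto_id.mono_left nhdsWithin_le_nhds).const_add _).const_mul _).const_add _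
    exact this.eventually (gt_mem_nhds (by linarith [hcξ i]))
  obtain ⟨ε, ⟨⟨hε1, hε2⟩, hε3⟩, hε⟩ := ((((eventually_all.2 hsmall).and
    (eventually_all.2 fun i => (hf i).eventually_lt_of_clarkeDeriv_lt (hc i))).and
    (hG.eventually_lt_of_clarkeDeriv_lt hcon)).and eventually_mem_nhdsWithin).exists
  obtain ⟨t, ⟨⟨⟨y, hyΩ, hy⟩, h1⟩, h2⟩, ht⟩ :=
    ((((eventually_exists_mem_norm_sub_le hxΩ hd hε).and (eventually_all.2 hε2)).and
      hε3).and eventually_mem_nhdsWithin).exists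
  have ht : 0 < t := ht
  have hGy := h2 y hy
  rw [mul_zero, add_zero] at hGy
  refine hx.2 ⟨y, ⟨hyΩ, (hT.feasible_iff y).2 fun s hs => ?_⟩, fun i => ?_⟩
  · exact (apply_le_dualSupport hball hs (g y)).trans (hGy.le.trans hGx)
  · have h3 := h1 i y hy
    have h4 : ‖y - xbar‖ ≤ t * (‖d‖ + ε) := by
      have h5 := norm_add_le (y - (xbar + t • d)) (t • d)
      rw [sub_add_eq_sub_sub, sub_add_cancel, ← sub_add_eq_sub_sub, norm_smul,
        Real.norm_of_nonneg ht.le] at h5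
      linarith
    have h6 := mul_le_mul_of_nonneg_right h4 (hξ i)
    have h7 := mul_neg_of_pos_of_neg ht (hε1 i)
    linarith

end Optimality

/-! ### The multiplier rule -/

theorem proposition4p1
    {X : Type*} [NormedAddCommGroup X] [NormedSpace ℝ X] [CompleteSpace X]
    {Y : Type*} [NormedAddCommGroup Y] [NormedSpace ℝ Y]
    {m : ℕ} (f : Fin m → X → ℝ) (hf : ∀ i, LocallyLipschitz (f i))
    (Ω : Set X) (hΩne : Ω.Nonempty) (hΩ : IsClosed Ω)
    (K : ProperCone ℝ Y) (g : X → Y) (hg : Continuous g) (hgK : IsConeConvex K g)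
    (T : Set (StrongDual ℝ Y)) (hT : IsIndexSet K g T)
    (ξ : Fin m → ℝ) (hξ : ∀ i, 0 ≤ ξ i) (hξ0 : ξ ≠ 0)
    (xbar : X) (hx : IsQuasiWeaklyPareto f (coneFeasible Ω K g) ξ xbar)
    (hU : ∃ d ∈ clarkeTangentCone Ω xbar, clarkeDeriv (supFun g T) xbar d < 0)
    (hcl : IsWeakStarClosed
      (convexHull ℝ (⋃ s ∈ activeIndices g T xbar, clarkeSubdiff (scalarization g s) xbar))) :
    ∃ lam : Fin m → ℝ, (∀ i, 0 ≤ lam i) ∧ ∑ i, lam i = 1 ∧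
      ∃ ζ ∈ positivePolar K,
        (0 : StrongDual ℝ X) ∈
          ∑ i, lam i • clarkeSubdiff (f i) xbar
            + clarkeSubdiff (scalarization g ζ) xbar
            + (∑ i, lam i * ξ i) • Metric.closedBall (0 : StrongDual ℝ X) 1
            + clarkeNormalCone Ω xbar := by

  have hxΩ : xbar ∈ Ω := hx.1.1
  obtain ⟨d₀, hd₀, hd₀G⟩ := hU
  have hne : T.Nonempty := by
    by_contra! h
    rw [h, clarkeDeriv_supFun_empty] at hd₀G
    exact hd₀G.false
  have hball : T ⊆ Metric.closedBall 0 1 := hT.subset.trans inter_subset_right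
  have hP := isSublinear_dualSupport hball hne
  have hPle : ∀ y, dualSupport T y ≤ ‖y‖ := fun y =>
    dualSupport_le hne fun s hs => apply_le_norm_of_subset_closedBall hball hs y
  have hPK : ∀ k ∈ K, dualSupport T (-k) ≤ 0 := fun k hk => dualSupport_le hne fun s hs => by
    simpa using (hT.subset hs).1 k hk
  have hGcont : Continuous (supFun g T) :=
    (hP.continuous_of_le_norm zero_le_one (by simpa using hPle)).comp hg
  have hGconv : ConvexOn ℝ univ (supFun g T) := hgK.convexOn_comp hP hPK
  have hG : LocallyLipschitz (supFun g T) := locallyLipschitzOn_univ.1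
    ((hGconv.locallyLipschitzOn_iff_continuousOn isOpen_univ).2 hGcont.continuousOn)
  have hnorm : IsSublinear (fun d : X => ‖d‖) :=
    ⟨fun c hc d => by rw [norm_smul, Real.norm_of_nonneg hc.le], norm_add_le⟩
  obtain ⟨S, hS0, hS⟩ := exists_convexCone_coe_eq_clarkeTangentCone hxΩ
  let q : Option (Fin m) → X → ℝ := fun j => j.elim (clarkeDeriv (supFun g T) xbar)
    fun i d => clarkeDeriv (f i) xbar d + ξ i * ‖d‖
  have hq : ∀ j, IsSublinear (q j) := by
    rintro (_ | i)
    · exact hG.isSublinear_clarkeDeriv xbar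
    · exact ((hf i).isSublinear_clarkeDeriv xbar).add (hnorm.const_mul (hξ i))
  obtain ⟨a, l, ha, ha1, hl, hlS⟩ := IsSublinear.exists_multipliers hq S hS0 fun d hd => by
    rcases hx.exists_nonneg hf hξ hT hne hG ((hS d).1 hd) with ⟨i, hi⟩ | h
    · exact ⟨some i, hi⟩
    · exact ⟨none, h⟩
  rw [Fintype.sum_option] at ha1
  have hlG : ∀ d, l none d ≤ a none * clarkeDeriv (supFun g T) xbar d := hl none
  have hlf : ∀ i d, l (some i) d ≤ a (some i) * (clarkeDeriv (f i) xbar d + ξ i * ‖d‖) :=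
    fun i => hl (some i)
  obtain ⟨σ, hσ⟩ : ∃ σ, σ = ∑ i, a (some i) := ⟨_, rfl⟩
  -- If σ = 0, the constraint multiplier is 1 and the sum of the functionals at d₀ is at most G°(x̄;
  -- d₀) < 0, although d₀ is tangent.
  have hσ0 : 0 < σ := by
    refine (hσ ▸ Finset.sum_nonneg fun i _ => ha (some i)).lt_of_ne' fun h => ?_
    rw [h] at hσ
    have hz : ∀ i, a (some i) = 0 := fun i =>
      (Finset.sum_eq_zero_iff_of_nonneg fun i _ => ha (some i)).1 hσ.symm i (Finset.mem_univ i)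
    have h1 := hlS d₀ ((hS d₀).2 hd₀)
    rw [Fintype.sum_option] at h1
    have h2 : ∑ i, l (some i) d₀ ≤ 0 := Finset.sum_nonpos fun i _ => by
      simpa [hz i] using hlf i d₀
    have h3 := hlG d₀
    rw [← hσ, add_zero] at ha1
    rw [ha1, one_mul] at h3
    linarith
  have hσi : 0 ≤ σ⁻¹ := (inv_pos.2 hσ0).le
  have hlam : ∀ i, 0 ≤ σ⁻¹ * a (some i) := fun i => mul_nonneg hσi (ha _)
  have hsplit : ∀ i, ∃ A B : X →ₗ[ℝ] ℝ,
      (∀ d, A d ≤ σ⁻¹ * a (some i) * clarkeDeriv (f i) xbar d) ∧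
      (∀ d, B d ≤ σ⁻¹ * a (some i) * ξ i * ‖d‖) ∧ σ⁻¹ • l (some i) = A + B := fun i =>
    (((hf i).isSublinear_clarkeDeriv xbar).const_mul (hlam i)).exists_add_eq
      (hnorm.const_mul (mul_nonneg (hlam i) (hξ i))) _ fun d => by
        have := mul_le_mul_of_nonneg_left (hlf i d) hσi
        rw [LinearMap.smul_apply, smul_eq_mul]
        linarith
  choose A B hA hB hAB using hsplit
  choose k hk hkA using fun i => (hf i).exists_mem_smul_clarkeSubdiff (hlam i) (A i) (hA i)
  obtain ⟨ρ, hρ⟩ : ∃ ρ, ρ = ∑ i, σ⁻¹ * a (some i) * ξ i := ⟨_, rfl⟩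
  have hρ0 : 0 ≤ ρ := hρ ▸ Finset.sum_nonneg fun i _ => mul_nonneg (hlam i) (hξ i)
  have hBle : ∀ d, (∑ i, B i) d ≤ ρ * ‖d‖ := fun d => by
    rw [LinearMap.sum_apply, hρ, Finset.sum_mul]
    exact Finset.sum_le_sum fun i _ => hB i d
  have hBnorm : ∀ d, ‖(∑ i, B i) d‖ ≤ ρ * ‖d‖ := fun d => abs_le'.2 ⟨hBle d, by
    simpa using hBle (-d)⟩
  let b : StrongDual ℝ X := (∑ i, B i).mkContinuous ρ hBnorm
  have hb : b ∈ ρ • Metric.closedBall (0 : StrongDual ℝ X) 1 := by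
    rw [smul_closedBall _ _ zero_le_one, smul_zero, Real.norm_of_nonneg hρ0, mul_one,
      mem_closedBall_zero_iff]
    exact LinearMap.mkContinuous_norm_le _ hρ0 _
  have hμ : 0 ≤ σ⁻¹ * a none := mul_nonneg hσi (ha _)
  have hl₀ : ∀ d, (σ⁻¹ • l none) d ≤ σ⁻¹ * a none * clarkeDeriv (supFun g T) xbar d := fun d => by
    have := mul_le_mul_of_nonneg_left (hlG d) hσi
    rw [LinearMap.smul_apply, smul_eq_mul]
    linarith
  -- Only a continuous version of the constraint functional is kept; its subgradient property is
  -- obtained for g_ζ below.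
  obtain ⟨k₀, -, hk₀⟩ := hG.exists_mem_smul_clarkeSubdiff hμ _ hl₀
  obtain ⟨ζ, hζ, hζg⟩ := hgK.exists_linear_of_subgradient (hP.const_mul hμ)
    (fun y hy => mul_nonpos_of_nonneg_of_nonpos hμ (hPK y hy)) (xbar := xbar) (σ⁻¹ • l none)
    fun x => by
      have h1 := hGconv.clarkeDeriv_le_sub hGcont xbar (x - xbar)
      rw [add_sub_cancel] at h1
      rw [← mul_sub]
      exact (hl₀ _).trans (mul_le_mul_of_nonneg_left h1 hμ)
  have hζle : ∀ y, ζ y ≤ σ⁻¹ * a none * ‖y‖ := fun y =>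
    (hζ y).trans (mul_le_mul_of_nonneg_left (hPle y) hμ)
  let z : StrongDual ℝ Y := ζ.mkContinuous (σ⁻¹ * a none) fun y => abs_le'.2 ⟨hζle y, by
    simpa using hζle (-y)⟩
  have hz : z ∈ positivePolar K := fun y hy => by
    have h1 := (hζ (-y)).trans (mul_nonpos_of_nonneg_of_nonpos hμ (hPK y hy))
    rw [map_neg] at h1
    exact neg_nonpos.1 h1
  refine ⟨fun i => σ⁻¹ * a (some i), hlam, ?_, z, hz, ?_⟩
  · rw [← Finset.mul_sum, ← hσ, inv_mul_cancel₀ hσ0.ne']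
  have hk₀z : k₀ ∈ clarkeSubdiff (scalarization g z) xbar :=
    mem_clarkeSubdiff_scalarization hg hgK hz fun x => (hk₀ _).trans_le (hζg x)
  -- The sum k + k₀ + b is σ⁻¹ times the sum of the functionals l j, which is nonnegative on the
  -- tangent cone.
  have hn : -(∑ i, k i + k₀ + b) ∈ clarkeNormalCone Ω xbar := fun d hd => by
    have h1 := mul_nonneg hσi (hlS d ((hS d).2 hd))
    rw [Fintype.sum_option, mul_add, Finset.mul_sum] at h1
    have h2 : ∀ i, σ⁻¹ * l (some i) d = k i d + B i d := fun i => by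
      rw [hkA, ← LinearMap.add_apply, ← hAB, LinearMap.smul_apply, smul_eq_mul]
    have h3 : k₀ d = σ⁻¹ * l none d := hk₀ d
    have h4 : b d = ∑ i, B i d := LinearMap.sum_apply _ _ _
    rw [Finset.sum_congr rfl fun i _ => h2 i, Finset.sum_add_distrib] at h1
    simp only [neg_apply, add_apply, sum_apply]
    linarith
  rw [← hρ]
  exact Set.mem_add.2 ⟨_, Set.add_mem_add (Set.add_mem_add
    (Set.finsetSum_mem_finsetSum _ _ _ fun i _ => hk i) hk₀z) hb, _, hn, add_neg_cancel _⟩
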